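/- Let $q$ be a complex number with $|q|<1$, and write $(a;q)_n:=\prod_{k=0}^{n-1}(1-aq^k)$, so that $(q;q^2)_n=\prod_{k=0}^{n-1}(1-q^{2k+1})$. Then all the series below, viewed as series in $n$, converge absolutely, and \[ \sum_{n=1}^{\infty}\frac{(-1)^{n}q^{n^{2}+n}}{(1+q^{2n})(q;q^{2})_{n}}=\sum_{n=1}^{\infty}\sum_{j=-n}^{n}(-1)^{n}q^{2n^{2}+j^{2}}-\sum_{n=1}^{\infty}(-1)^{n}q^{3n^{2}}. \] Moreover, the left-hand side also equals \[ \sum_{n=1}^{\infty}\sum_{j=-n+1}^{n}(-1)^{n}q^{2n^{2}+j^{2}}. \] -/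

import Mathlib

/-- The `q`-shifted factorial `(a; q)_n = ∏_{k=0}^{n-1} (1 - a q^k)`, with `(a; q)_0 = 1`. -/
def qShiftedFactorial (a q : ℂ) (n : ℕ) : ℂ :=
  ∏ k ∈ Finset.range n, (1 - a * q ^ k)

/-!
The proof is Bailey's method made explicit. Put `p = q²` and write `(a)_k = (a; p)_k`. The terminating
series `u n = ∑ₖ (p⁻ⁿ)_k (pⁿ⁺¹)_k pᵏ / ((1 + pᵏ) (p)_k (q)_k)` is evaluated by adding two neighbours:
in `u (n + 1) + u n` the factor `1 + pᵏ` cancels (`shiftedPair_succ_add`), and what is left is a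
`q`-Chu–Vandermonde sum equal to `(-1)ⁿ⁺¹ q^{(n+1)²}`. Hence `u n` is `(-1)ⁿ / 2` times the theta
polynomial `∑_{|j| ≤ n} q^{j²}` (`sum_shiftedPair_mul_weight`).

On the other hand, for fixed `k` the series `∑ₙ (p^{n²} - p^{(n+1)²}) (p⁻ⁿ)_k (pⁿ⁺¹)_k` satisfies a
first-order recursion in `k`, by telescoping in `n` (`boundaryTerm_sub`, `pairSum_succ`), and so
equals `(-1)ᵏ p^{k(k-1)/2} (p)_k` (`tendsto_pairSum`). Computing
`∑ₙ (p^{n²} - p^{(n+1)²}) u n` by summing first over `n` gives the Eulerian series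
(`limit_mul_weight`), and by summing first over `k` gives, after summation by parts, the double sum
less the theta series (`tsum_pairSum_mul_weight`). The interchange is done for partial sums in `n`,
with the limit justified by dominated convergence through the uniform bound `norm_pairSum_le`. The
second form of the identity only removes the term `j = -n` from each inner sum.
-/

open Filter Topology Finset

/-! ### Shifted factorials and the `q`-Chu–Vandermonde sum -/

theorem qShiftedFactorial_zero (a p : ℂ) : qShiftedFactorial a p 0 = 1 := by
  simp [qShiftedFactorial]

theorem qShiftedFactorial_succ (a p : ℂ) (n : ℕ) :
    qShiftedFactorial a p (n + 1) = qShiftedFactorial a p n * (1 - a * p ^ n) := by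
  simp [qShiftedFactorial, prod_range_succ]

theorem qShiftedFactorial_succ' (a p : ℂ) (n : ℕ) :
    qShiftedFactorial a p (n + 1) = (1 - a) * qShiftedFactorial (a * p) p n := by
  simp [qShiftedFactorial, prod_range_succ', pow_succ', mul_assoc, mul_comm]

theorem qShiftedFactorial_ne_zero {a p : ℂ} (h : ∀ k : ℕ, 1 - a * p ^ k ≠ 0) (n : ℕ) :
    qShiftedFactorial a p n ≠ 0 :=
  prod_ne_zero_iff.2 fun k _ => h k

theorem qShiftedFactorial_inv_pow_eq_zero {p : ℂ} (hp : p ≠ 0) {n k : ℕ} (h : n < k) :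
    qShiftedFactorial (p ^ n)⁻¹ p k = 0 :=
  prod_eq_zero (mem_range.2 h) (by simp [hp])

theorem norm_qShiftedFactorial_le {a p : ℂ} (ha : ‖a‖ ≤ 1) (hp : ‖p‖ ≤ 1) (n : ℕ) :
    ‖qShiftedFactorial a p n‖ ≤ 2 ^ n := by
  rw [qShiftedFactorial, norm_prod]
  refine (prod_le_prod (fun _ _ => norm_nonneg _) (g := fun _ => 2) fun k _ => ?_).trans (by simp)
  refine (norm_sub_le _ _).trans ?_
  rw [norm_one, norm_mul, norm_pow]
  have := mul_le_one₀ ha (by positivity) (pow_le_one₀ (norm_nonneg p) hp (n := k))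
  linarith

theorem pow_le_norm_qShiftedFactorial {a p : ℂ} {s : ℝ} (hs : s ≤ 1) (ha : ‖a‖ ≤ s)
    (hp : ‖p‖ ≤ 1) (n : ℕ) : (1 - s) ^ n ≤ ‖qShiftedFactorial a p n‖ := by
  rw [qShiftedFactorial, norm_prod]
  refine le_trans (by simp) (prod_le_prod (f := fun _ => 1 - s) (fun _ _ => by linarith)
    fun k _ => ?_)
  have h1 := norm_sub_norm_le (1 : ℂ) (a * p ^ k)
  rw [norm_one, norm_mul, norm_pow] at h1
  have := mul_le_of_le_one_right (norm_nonneg a) (pow_le_one₀ (norm_nonneg p) hp (n := k))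
  linarith

theorem one_sub_ne_zero_of_norm_lt_one {z : ℂ} (hz : ‖z‖ < 1) : 1 - z ≠ 0 := by
  intro h
  rw [← sub_eq_zero.1 h] at hz
  simp at hz

/-- The `q`-Chu–Vandermonde sum, terminating at `k = n`; the range is left free above `n` so that
sums for different `n` can be added termwise. -/
theorem sum_qShiftedFactorial_vandermonde {p : ℂ} (hp : p ≠ 0)
    (hp1 : ∀ k : ℕ, 1 - p * p ^ k ≠ 0) (n : ℕ) :
    ∀ (M : ℕ) (b c : ℂ), n < M → (∀ k : ℕ, 1 - c * p ^ k ≠ 0) →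
      ∑ k ∈ range M, qShiftedFactorial (p ^ n)⁻¹ p k * qShiftedFactorial b p k * p ^ k /
        (qShiftedFactorial p p k * qShiftedFactorial c p k) =
      ∏ i ∈ range n, (b - c * p ^ i) / (1 - c * p ^ i) := by
  induction n with
  | zero =>
    intro M b c hM hc
    obtain ⟨M, rfl⟩ := Nat.exists_eq_add_of_lt hM
    rw [sum_range_succ', sum_eq_zero]
    · simp [qShiftedFactorial_zero]
    · intro k _
      rw [qShiftedFactorial_inv_pow_eq_zero hp (Nat.succ_pos k)]
      simp
  | succ n ih =>
    intro M b c hM hc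
    obtain ⟨M, rfl⟩ : ∃ m, M = m + 1 := ⟨M - 1, by omega⟩
    have hc' : ∀ k : ℕ, 1 - c * p * p ^ k ≠ 0 := fun k => by
      have := hc (k + 1)
      rwa [pow_succ', ← mul_assoc] at this
    have h1c : 1 - c ≠ 0 := by simpa using hc 0
    -- `(p⁻ⁿ⁻¹)_k - (p⁻ⁿ)_k` has a factor `1 - p ^ k`, so the difference is a shifted sum.
    have key : ∑ k ∈ range (M + 1), qShiftedFactorial (p ^ (n + 1))⁻¹ p k *
          qShiftedFactorial b p k * p ^ k / (qShiftedFactorial p p k * qShiftedFactorial c p k) =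
        (∑ k ∈ range (M + 1), qShiftedFactorial (p ^ n)⁻¹ p k *
          qShiftedFactorial b p k * p ^ k / (qShiftedFactorial p p k * qShiftedFactorial c p k)) -
        (p ^ n)⁻¹ * ((1 - b) / (1 - c)) * ∑ k ∈ range M, qShiftedFactorial (p ^ n)⁻¹ p k *
          qShiftedFactorial (b * p) p k * p ^ k /
            (qShiftedFactorial p p k * qShiftedFactorial (c * p) p k) := by
      rw [sum_range_succ', sum_range_succ' _ M, mul_sum, add_sub_right_comm, ← sum_sub_distrib]
      congr 1
      · refine sum_congr rfl fun k _ => ?_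
        have e : (p ^ (n + 1))⁻¹ * p = (p ^ n)⁻¹ := by
          rw [pow_succ]
          field_simp
        rw [qShiftedFactorial_succ' (p ^ (n + 1))⁻¹, e, qShiftedFactorial_succ (p ^ n)⁻¹,
          qShiftedFactorial_succ' b, qShiftedFactorial_succ p, qShiftedFactorial_succ' c]
        have := qShiftedFactorial_ne_zero hp1 k
        have := qShiftedFactorial_ne_zero hc' k
        have := hp1 k
        have h2 : 1 - p ^ (k + 1) ≠ 0 := by rwa [pow_succ']
        field_simp
        ring
    have shift : ∏ i ∈ range n, (b * p - c * p * p ^ i) / (1 - c * p * p ^ i) =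
        p ^ n * (∏ i ∈ range n, (b - c * p ^ i) / (1 - c * p ^ i)) * (1 - c) / (1 - c * p ^ n) := by
      clear key ih hM
      induction n with
      | zero => simp [h1c]
      | succ n ih =>
        rw [prod_range_succ, ih, prod_range_succ]
        have := hc n
        have := hc (n + 1)
        have := hc' n
        have e : 1 - c * p * p ^ n = 1 - c * p ^ (n + 1) := by ring
        rw [e]
        field_simp
        ring
    rw [key, ih _ b c (by omega) hc, ih _ (b * p) (c * p) (by omega) hc', shift, prod_range_succ]
    have := hc n
    have : p ^ n ≠ 0 := pow_ne_zero _ hp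
    field_simp
    ring

/-- With base `q²`, `b = q²ⁿ` and `c = q` the `q`-Chu–Vandermonde product collapses, since its
numerator is the denominator read backwards up to a monomial. -/
theorem sum_vandermonde_eq_theta_term {q : ℂ} (hq0 : q ≠ 0) (hq : ‖q‖ < 1) {n M : ℕ}
    (hM : n < M) :
    ∑ k ∈ range M, qShiftedFactorial ((q ^ 2) ^ n)⁻¹ (q ^ 2) k *
        qShiftedFactorial ((q ^ 2) ^ n) (q ^ 2) k * (q ^ 2) ^ k /
        (qShiftedFactorial (q ^ 2) (q ^ 2) k * qShiftedFactorial q (q ^ 2) k) =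
      (-1) ^ n * q ^ n ^ 2 := by
  have hodd (k : ℕ) : 1 - q * (q ^ 2) ^ k ≠ 0 := by
    rw [← pow_mul, ← pow_succ']
    exact one_sub_ne_zero_of_norm_lt_one
      (by rw [norm_pow]; exact pow_lt_one₀ (norm_nonneg _) hq (by omega))
  have heven (k : ℕ) : 1 - q ^ 2 * (q ^ 2) ^ k ≠ 0 := by
    rw [← pow_mul, ← pow_add]
    exact one_sub_ne_zero_of_norm_lt_one
      (by rw [norm_pow]; exact pow_lt_one₀ (norm_nonneg _) hq (by omega))
  rw [sum_qShiftedFactorial_vandermonde (pow_ne_zero 2 hq0) heven n M _ _ hM hodd, prod_div_distrib,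
    div_eq_iff (prod_ne_zero_iff.2 fun k _ => hodd k), ← prod_range_reflect (fun i => 1 - q * _)]
  have hsq : ∀ m : ℕ, (-1) ^ m * q ^ m ^ 2 = ∏ i ∈ range m, -(q * (q ^ 2) ^ i) := by
    intro m
    induction m with
    | zero => simp
    | succ m ih => rw [prod_range_succ, ← ih]; ring
  rw [hsq, ← prod_mul_distrib]
  refine prod_congr rfl fun i hi => ?_
  obtain ⟨j, rfl⟩ : ∃ j, n = i + 1 + j := ⟨n - (i + 1), by have := mem_range.1 hi; omega⟩
  rw [show i + 1 + j - 1 - i = j by omega]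
  ring

/-! ### The terminating series as a theta polynomial -/

/-- The product `(p⁻ⁿ; p)_k (pⁿ⁺¹; p)_k`, the part of the terminating series in `k` that depends
on `n`; it vanishes for `k > n`. -/
noncomputable def shiftedPair (p : ℂ) (n k : ℕ) : ℂ :=
  qShiftedFactorial (p ^ n)⁻¹ p k * qShiftedFactorial (p ^ (n + 1)) p k

theorem shiftedPair_zero (p : ℂ) (n : ℕ) : shiftedPair p n 0 = 1 := by
  simp [shiftedPair, qShiftedFactorial_zero]

theorem shiftedPair_eq_zero {p : ℂ} (hp : p ≠ 0) {n k : ℕ} (h : n < k) :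
    shiftedPair p n k = 0 := by
  rw [shiftedPair, qShiftedFactorial_inv_pow_eq_zero hp h, zero_mul]

/-- Adding two consecutive pairs produces the factor `1 + p ^ k`, which cancels the one in the
denominator of the series. -/
theorem shiftedPair_succ_add {p : ℂ} (hp : p ≠ 0) (n k : ℕ) :
    shiftedPair p (n + 1) k + shiftedPair p n k =
      (1 + p ^ k) * (qShiftedFactorial (p ^ (n + 1))⁻¹ p k * qShiftedFactorial (p ^ (n + 1)) p k) := by
  cases k with
  | zero => norm_num [shiftedPair, qShiftedFactorial_zero]
  | succ k =>
    have e : (p ^ (n + 1))⁻¹ * p = (p ^ n)⁻¹ := by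
      rw [pow_succ]
      field_simp
    rw [shiftedPair, shiftedPair, qShiftedFactorial_succ' (p ^ (n + 1))⁻¹, e,
      qShiftedFactorial_succ (p ^ n)⁻¹, qShiftedFactorial_succ' (p ^ (n + 1)),
      ← pow_succ, qShiftedFactorial_succ (p ^ (n + 1 + 1))]
    generalize qShiftedFactorial (p ^ n)⁻¹ p k = A
    generalize qShiftedFactorial (p ^ (n + 1 + 1)) p k = B
    simp only [pow_succ]
    field_simp
    ring

/-- The theta polynomial `∑_{j=-n}^{n} q^{j²}`. -/
noncomputable def thetaSum (q : ℂ) (n : ℕ) : ℂ :=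
  ∑ j ∈ Icc (-(n : ℤ)) (n : ℤ), q ^ (j.natAbs ^ 2)

theorem thetaSum_eq_add (q : ℂ) (n : ℕ) :
    thetaSum q n = q ^ n ^ 2 + ∑ j ∈ Icc (-(n : ℤ) + 1) (n : ℤ), q ^ (j.natAbs ^ 2) := by
  rw [thetaSum, ← insert_Icc_add_one_left_eq_Icc (by omega), sum_insert (by simp)]
  simp

theorem thetaSum_succ (q : ℂ) (n : ℕ) :
    thetaSum q (n + 1) = thetaSum q n + 2 * q ^ (n + 1) ^ 2 := by
  have h : Icc (-((n + 1 : ℕ) : ℤ) + 1) ((n + 1 : ℕ) : ℤ) =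
      insert ((n + 1 : ℕ) : ℤ) (Icc (-(n : ℤ)) (n : ℤ)) := by
    ext j
    simp only [mem_Icc, mem_insert]
    omega
  rw [thetaSum_eq_add, h, sum_insert (by simp), Int.natAbs_natCast, thetaSum]
  ring

/-- The factor `1 / ((1 + q²ᵏ) (q²; q²)_k (q; q²)_k)` multiplying
`q²ᵏ (q⁻²ⁿ; q²)_k (q²ⁿ⁺²; q²)_k` in the terminating series. -/
noncomputable def weight (q : ℂ) (k : ℕ) : ℂ :=
  ((1 + (q ^ 2) ^ k) * (qShiftedFactorial (q ^ 2) (q ^ 2) k * qShiftedFactorial q (q ^ 2) k))⁻¹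

theorem norm_one_add_pow_ge {q : ℂ} (hq : ‖q‖ < 1) (k : ℕ) :
    1 - ‖q‖ ≤ ‖1 + (q ^ 2) ^ k‖ := by
  cases k with
  | zero =>
    norm_num
    linarith [norm_nonneg q]
  | succ k =>
    have h := norm_sub_norm_le (1 : ℂ) (-(q ^ 2) ^ (k + 1))
    rw [norm_one, norm_neg, sub_neg_eq_add, norm_pow, norm_pow, ← pow_mul] at h
    have := pow_le_of_le_one (norm_nonneg q) hq.le (n := 2 * (k + 1)) (by omega)
    linarith

theorem one_add_pow_ne_zero {q : ℂ} (hq : ‖q‖ < 1) (k : ℕ) : 1 + (q ^ 2) ^ k ≠ 0 :=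
  norm_pos_iff.1 (by linarith [norm_one_add_pow_ge hq k])

/-- The terminating series is, up to sign, half a theta polynomial. -/
theorem sum_shiftedPair_mul_weight {q : ℂ} (hq0 : q ≠ 0) (hq : ‖q‖ < 1) (n : ℕ) {M : ℕ}
    (hM : n < M) :
    ∑ k ∈ range M, shiftedPair (q ^ 2) n k * (q ^ 2) ^ k * weight q k =
      (-1) ^ n * thetaSum q n / 2 := by
  have hp : q ^ 2 ≠ 0 := pow_ne_zero 2 hq0
  induction n with
  | zero =>
    obtain ⟨M, rfl⟩ : ∃ m, M = m + 1 := ⟨M - 1, by omega⟩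
    rw [sum_range_succ', sum_eq_zero]
    · norm_num [shiftedPair_zero, weight, thetaSum, qShiftedFactorial_zero]
    · intro k _
      rw [shiftedPair_eq_zero hp (Nat.succ_pos k)]
      simp
  | succ n ih =>
    have h := sum_vandermonde_eq_theta_term hq0 hq hM
    have hsum : ∑ k ∈ range M, shiftedPair (q ^ 2) (n + 1) k * (q ^ 2) ^ k * weight q k +
        ∑ k ∈ range M, shiftedPair (q ^ 2) n k * (q ^ 2) ^ k * weight q k =
        (-1) ^ (n + 1) * q ^ (n + 1) ^ 2 := by
      rw [← h, ← sum_add_distrib]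
      refine sum_congr rfl fun k _ => ?_
      rw [← add_mul, ← add_mul, shiftedPair_succ_add hp, weight, mul_inv, div_eq_mul_inv]
      have := one_add_pow_ne_zero hq k
      field_simp
    rw [ih (by omega)] at hsum
    rw [eq_sub_of_add_eq hsum, thetaSum_succ]
    ring

/-! ### Telescoping in `n` -/

/-- The partial sums of `∑ (p^{n²} - p^{(n+1)²}) (p⁻ⁿ; p)_k (pⁿ⁺¹; p)_k`. -/
noncomputable def pairSum (p : ℂ) (N k : ℕ) : ℂ :=
  ∑ n ∈ range N, (p ^ n ^ 2 - p ^ (n + 1) ^ 2) * shiftedPair p n k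

/-- The boundary term `p^{n²} (p⁻ⁿ; p)_k (pⁿ; p)_k` of the telescoping sum. -/
noncomputable def boundaryTerm (p : ℂ) (n k : ℕ) : ℂ :=
  p ^ n ^ 2 * (qShiftedFactorial (p ^ n)⁻¹ p k * qShiftedFactorial (p ^ n) p k)

/-- The telescoping identity behind the recursion in `k` for `pairSum`. -/
theorem boundaryTerm_sub {p : ℂ} (hp : p ≠ 0) (n k : ℕ) :
    boundaryTerm p n (k + 1) - boundaryTerm p (n + 1) (k + 1) =
      (p ^ n ^ 2 - p ^ (n + 1) ^ 2) *
        (shiftedPair p n (k + 1) + p ^ k * (1 - p ^ (k + 1)) * shiftedPair p n k) := by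
  have e : (p ^ (n + 1))⁻¹ * p = (p ^ n)⁻¹ := by
    rw [pow_succ]
    field_simp
  rw [boundaryTerm, boundaryTerm, shiftedPair, shiftedPair,
    qShiftedFactorial_succ' (p ^ (n + 1))⁻¹, e,
    qShiftedFactorial_succ (p ^ n)⁻¹, qShiftedFactorial_succ' (p ^ n),
    ← pow_succ, qShiftedFactorial_succ (p ^ (n + 1))]
  have e2 : p ^ (n + 1) ^ 2 = p ^ n ^ 2 * (p ^ n) ^ 2 * p := by ring
  rw [e2]
  generalize qShiftedFactorial (p ^ n)⁻¹ p k = A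
  generalize qShiftedFactorial (p ^ (n + 1)) p k = B
  simp only [pow_succ p]
  field_simp
  ring

theorem pairSum_zero (p : ℂ) (N : ℕ) : pairSum p N 0 = 1 - p ^ N ^ 2 := by
  simp only [pairSum, shiftedPair_zero, mul_one]
  rw [sum_range_sub' (fun n => p ^ n ^ 2)]
  simp

/-- Iterating this recursion gives both the limit of `pairSum` as `N → ∞` and a bound uniform in
`N`. -/
theorem pairSum_succ {p : ℂ} (hp : p ≠ 0) (N k : ℕ) :
    pairSum p N (k + 1) =
      -(p ^ k * (1 - p ^ (k + 1))) * pairSum p N k - boundaryTerm p N (k + 1) := by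
  have h0 : boundaryTerm p 0 (k + 1) = 0 := by
    rw [boundaryTerm, qShiftedFactorial_inv_pow_eq_zero hp (Nat.succ_pos k)]
    simp
  have h : pairSum p N (k + 1) + p ^ k * (1 - p ^ (k + 1)) * pairSum p N k =
      boundaryTerm p 0 (k + 1) - boundaryTerm p N (k + 1) := by
    rw [← sum_range_sub' (fun n => boundaryTerm p n (k + 1)), pairSum, pairSum, mul_sum,
      ← sum_add_distrib]
    refine sum_congr rfl fun n _ => ?_
    rw [boundaryTerm_sub hp]
    ring
  linear_combination h + h0

theorem pairSum_eq_zero {p : ℂ} (hp : p ≠ 0) {N k : ℕ} (h : N ≤ k) : pairSum p N k = 0 :=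
  sum_eq_zero fun n hn => by
    rw [shiftedPair_eq_zero hp ((mem_range.1 hn).trans_le h), mul_zero]

theorem norm_boundaryTerm_le {p : ℂ} (hp : p ≠ 0) (hp1 : ‖p‖ ≤ 1) {N k : ℕ} (h : k ≤ N) :
    ‖boundaryTerm p N k‖ ≤ ‖p‖ ^ (N * (N - k)) * (4 ^ k * ‖p‖ ^ (∑ i ∈ range k, i)) := by
  -- Absorbing `p ^ (N * k)` into `(p⁻ᴺ; p)_k` removes the negative powers of `p`.
  have h1 : boundaryTerm p N k = p ^ (N * (N - k)) *
      ((∏ i ∈ range k, (p ^ N - p ^ i)) * qShiftedFactorial (p ^ N) p k) := by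
    have h2 : ∏ i ∈ range k, (p ^ N - p ^ i) =
        p ^ (N * k) * qShiftedFactorial (p ^ N)⁻¹ p k := by
      rw [pow_mul, qShiftedFactorial, ← card_range k, ← prod_const, card_range,
        ← prod_mul_distrib]
      refine prod_congr rfl fun i _ => ?_
      have := pow_ne_zero N hp
      field_simp
    obtain ⟨d, rfl⟩ := Nat.exists_eq_add_of_le h
    rw [boundaryTerm, h2, Nat.add_sub_cancel_left]
    ring
  have h3 : ‖∏ i ∈ range k, (p ^ N - p ^ i)‖ ≤ 2 ^ k * ‖p‖ ^ (∑ i ∈ range k, i) := by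
    rw [norm_prod, ← prod_pow_eq_pow_sum]
    refine (prod_le_prod (fun _ _ => norm_nonneg _) (g := fun i => 2 * ‖p‖ ^ i)
      fun i hi => ?_).trans (by simp [prod_mul_distrib])
    refine (norm_sub_le _ _).trans ?_
    rw [norm_pow, norm_pow]
    have := pow_le_pow_of_le_one (norm_nonneg p) hp1 ((mem_range.1 hi).le.trans h)
    linarith
  have h4 := norm_qShiftedFactorial_le (a := p ^ N) (p := p)
    (by rw [norm_pow]; exact pow_le_one₀ (norm_nonneg p) hp1) hp1 k
  rw [h1, norm_mul, norm_mul, norm_pow]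
  refine mul_le_mul_of_nonneg_left ?_ (by positivity)
  calc _ ≤ 2 ^ k * ‖p‖ ^ (∑ i ∈ range k, i) * 2 ^ k := by gcongr
    _ = (2 * 2) ^ k * ‖p‖ ^ (∑ i ∈ range k, i) := by rw [mul_pow]; ring
    _ = _ := by norm_num

theorem norm_pairSum_le {p : ℂ} (hp : p ≠ 0) (hp1 : ‖p‖ ≤ 1) (N k : ℕ) :
    ‖pairSum p N k‖ ≤ 2 * (4 ^ k * ‖p‖ ^ (∑ i ∈ range k, i)) := by
  induction k with
  | zero =>
    rw [pairSum_zero]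
    refine (norm_sub_le _ _).trans ?_
    have := pow_le_one₀ (norm_nonneg p) hp1 (n := N ^ 2)
    simp
    linarith
  | succ k ih =>
    by_cases hk : N ≤ k + 1
    · rw [pairSum_eq_zero hp hk, norm_zero]
      positivity
    have hb := norm_boundaryTerm_le hp hp1 (not_le.1 hk).le
    have hb' := mul_le_of_le_one_left (b := (4 : ℝ) ^ (k + 1) * ‖p‖ ^ (∑ i ∈ range (k + 1), i))
      (by positivity) (pow_le_one₀ (norm_nonneg p) hp1 (n := N * (N - (k + 1))))
    have h2 : ‖1 - p ^ (k + 1)‖ ≤ 2 := by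
      refine (norm_sub_le _ _).trans ?_
      have := pow_le_one₀ (norm_nonneg p) hp1 (n := k + 1)
      rw [norm_one, norm_pow]
      linarith
    rw [pairSum_succ hp]
    refine (norm_sub_le _ _).trans ?_
    rw [norm_mul, norm_neg, norm_mul, norm_pow]
    calc _ ≤ ‖p‖ ^ k * 2 * (2 * (4 ^ k * ‖p‖ ^ (∑ i ∈ range k, i))) +
          4 ^ (k + 1) * ‖p‖ ^ (∑ i ∈ range (k + 1), i) := by
          gcongr
          exact hb.trans hb'
      _ = _ := by
          rw [sum_range_succ, pow_add]
          ring

theorem tendsto_boundaryTerm {p : ℂ} (hp : p ≠ 0) (hp1 : ‖p‖ < 1) (k : ℕ) :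
    Tendsto (fun N => boundaryTerm p N k) atTop (𝓝 0) := by
  have h : Tendsto (fun N => ‖p‖ ^ N * (4 ^ k * ‖p‖ ^ (∑ i ∈ range k, i))) atTop (𝓝 0) := by
    simpa using (tendsto_pow_atTop_nhds_zero_of_lt_one (norm_nonneg p) hp1).mul_const _
  refine squeeze_zero_norm' ?_ h
  filter_upwards [eventually_gt_atTop k] with N hN
  refine (norm_boundaryTerm_le hp hp1.le hN.le).trans ?_
  gcongr 1
  exact pow_le_pow_of_le_one (norm_nonneg p) hp1.le (Nat.le_mul_of_pos_right N (by omega))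

theorem tendsto_pairSum {p : ℂ} (hp : p ≠ 0) (hp1 : ‖p‖ < 1) (k : ℕ) :
    Tendsto (fun N => pairSum p N k) atTop
      (𝓝 ((-1) ^ k * p ^ (∑ i ∈ range k, i) * qShiftedFactorial p p k)) := by
  induction k with
  | zero =>
    have h : Tendsto (fun N : ℕ => p ^ N ^ 2) atTop (𝓝 0) :=
      (tendsto_pow_atTop_nhds_zero_of_norm_lt_one hp1).comp
        (tendsto_pow_atTop two_ne_zero)
    simpa [pairSum_zero, qShiftedFactorial_zero] using h.const_sub 1
  | succ k ih =>
    have h := (ih.const_mul (-(p ^ k * (1 - p ^ (k + 1))))).sub (tendsto_boundaryTerm hp hp1 (k + 1))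
    simp only [← pairSum_succ hp, sub_zero] at h
    convert h using 2
    rw [sum_range_succ, qShiftedFactorial_succ, pow_add]
    ring

/-! ### The limit and the double sum -/

theorem norm_weight_le {q : ℂ} (hq : ‖q‖ < 1) (k : ℕ) :
    ‖weight q k‖ ≤ (1 - ‖q‖)⁻¹ * (((1 - ‖q‖) ^ 2)⁻¹) ^ k := by
  have hs : 0 < 1 - ‖q‖ := by linarith
  have hp : ‖q ^ 2‖ ≤ ‖q‖ := by
    rw [norm_pow]
    exact pow_le_of_le_one (norm_nonneg q) hq.le two_ne_zero
  have h1 := pow_le_norm_qShiftedFactorial hq.le hp (hp.trans hq.le) k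
  have h2 := pow_le_norm_qShiftedFactorial hq.le le_rfl (hp.trans hq.le) k
  rw [weight, norm_inv, norm_mul, norm_mul, inv_pow, ← mul_inv]
  refine inv_anti₀ (by positivity) ?_
  rw [show ((1 - ‖q‖) ^ 2) ^ k = (1 - ‖q‖) ^ k * (1 - ‖q‖) ^ k by
    rw [← mul_pow, sq]]
  have := norm_one_add_pow_ge hq k
  gcongr

/-- Triangular-number exponents beat geometric growth. -/
theorem summable_pow_mul_pow_sum_range {C r : ℝ} (hC : 0 < C) (hr0 : 0 < r) (hr : r < 1) :
    Summable fun k : ℕ => C ^ k * r ^ (∑ i ∈ range k, i) := by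
  refine summable_of_ratio_test_tendsto_lt_one zero_lt_one
    (Eventually.of_forall fun k => by positivity) ?_
  have h := (tendsto_pow_atTop_nhds_zero_of_lt_one hr0.le hr).const_mul C
  rw [mul_zero] at h
  refine h.congr fun k => ?_
  rw [Real.norm_of_nonneg (by positivity), Real.norm_of_nonneg (by positivity), sum_range_succ,
    pow_add, pow_succ C]
  field_simp
  ring

/-- The summand of the Eulerian series. -/
noncomputable def eulerTerm (q : ℂ) (n : ℕ) : ℂ :=
  (-1) ^ n * q ^ (n ^ 2 + n) / ((1 + q ^ (2 * n)) * qShiftedFactorial q (q ^ 2) n)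

/-- Multiplying by the weight turns the limit of `pairSum` into a term of the Eulerian series. -/
theorem limit_mul_weight {q : ℂ} (hq : ‖q‖ < 1) (k : ℕ) :
    (-1) ^ k * (q ^ 2) ^ (∑ i ∈ range k, i) * qShiftedFactorial (q ^ 2) (q ^ 2) k *
      (q ^ 2) ^ k * weight q k = eulerTerm q k := by
  have hne : qShiftedFactorial (q ^ 2) (q ^ 2) k ≠ 0 := by
    refine qShiftedFactorial_ne_zero (fun i => ?_) k
    rw [← pow_mul, ← pow_add]
    exact one_sub_ne_zero_of_norm_lt_one
      (by rw [norm_pow]; exact pow_lt_one₀ (norm_nonneg _) hq (by omega))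
  have he : k ^ 2 + k = 2 * (∑ i ∈ range k, i) + 2 * k := by
    clear hne
    induction k with
    | zero => simp
    | succ k ih =>
      rw [sum_range_succ]
      linarith [sq (k + 1), sq k]
  rw [eulerTerm, weight, he, pow_add q, pow_mul q, pow_mul q, div_eq_mul_inv, mul_inv, mul_inv,
    mul_inv]
  field_simp

/-- The bound, uniform in `N`, that lets the limit `N → ∞` pass under the sum over `k`. -/
noncomputable def dominatingTerm (q : ℂ) (k : ℕ) : ℝ :=
  2 * (1 - ‖q‖)⁻¹ * ((4 * ((1 - ‖q‖) ^ 2)⁻¹) ^ k * ‖q ^ 2‖ ^ (∑ i ∈ range k, i))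

theorem summable_dominatingTerm {q : ℂ} (hq0 : q ≠ 0) (hq : ‖q‖ < 1) :
    Summable (dominatingTerm q) := by
  have hs : 0 < 1 - ‖q‖ := by linarith
  refine (summable_pow_mul_pow_sum_range (by positivity)
    (norm_pos_iff.2 (pow_ne_zero 2 hq0)) ?_).mul_left _
  rw [norm_pow]
  exact pow_lt_one₀ (norm_nonneg _) hq two_ne_zero

theorem norm_pairSum_mul_weight_le {q : ℂ} (hq0 : q ≠ 0) (hq : ‖q‖ < 1) (N k : ℕ) :
    ‖pairSum (q ^ 2) N k * (q ^ 2) ^ k * weight q k‖ ≤ dominatingTerm q k := by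
  have hp1 : ‖q ^ 2‖ ≤ 1 := by
    rw [norm_pow]
    exact pow_le_one₀ (norm_nonneg _) hq.le
  have h1 := norm_pairSum_le (pow_ne_zero 2 hq0) hp1 N k
  have h2 := norm_weight_le hq k
  have h3 : ‖(q ^ 2) ^ k‖ ≤ 1 := by
    rw [norm_pow]
    exact pow_le_one₀ (norm_nonneg _) hp1
  rw [norm_mul, norm_mul, dominatingTerm]
  calc _ ≤ 2 * (4 ^ k * ‖q ^ 2‖ ^ (∑ i ∈ range k, i)) * 1 *
        ((1 - ‖q‖)⁻¹ * (((1 - ‖q‖) ^ 2)⁻¹) ^ k) := by gcongr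
    _ = _ := by
      rw [mul_pow]
      ring

theorem tendsto_pairSum_mul_weight {q : ℂ} (hq0 : q ≠ 0) (hq : ‖q‖ < 1) (k : ℕ) :
    Tendsto (fun N => pairSum (q ^ 2) N k * (q ^ 2) ^ k * weight q k) atTop
      (𝓝 (eulerTerm q k)) := by
  rw [← limit_mul_weight hq]
  exact ((tendsto_pairSum (pow_ne_zero 2 hq0)
    (by rw [norm_pow]; exact pow_lt_one₀ (norm_nonneg _) hq two_ne_zero) k).mul_const _).mul_const _

theorem summable_eulerTerm {q : ℂ} (hq0 : q ≠ 0) (hq : ‖q‖ < 1) : Summable (eulerTerm q) :=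
  Summable.of_norm_bounded (summable_dominatingTerm hq0 hq) fun k =>
    le_of_tendsto (tendsto_pairSum_mul_weight hq0 hq k).norm
      (Eventually.of_forall fun N => norm_pairSum_mul_weight_le hq0 hq N k)

/-- The term `(-1)ⁿ q^{2n²} ∑_{j=-n}^{n} q^{j²}` of the Hecke-type double sum. -/
noncomputable def heckeTerm (q : ℂ) (n : ℕ) : ℂ :=
  (-1) ^ n * q ^ (2 * n ^ 2) * thetaSum q n

/-- The left side is a finite sum over `k`; interchanging it with the one over `n` leaves the
terminating series, known to be half a theta polynomial. -/
theorem tsum_pairSum_mul_weight {q : ℂ} (hq0 : q ≠ 0) (hq : ‖q‖ < 1) (N : ℕ) :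
    ∑' k, pairSum (q ^ 2) N k * (q ^ 2) ^ k * weight q k =
      1 / 2 * ∑ n ∈ range N, heckeTerm q n + 1 / 2 * ∑ n ∈ range N, heckeTerm q (n + 1) -
        ∑ n ∈ range N, (-1) ^ (n + 1) * q ^ (3 * (n + 1) ^ 2) := by
  have hp : q ^ 2 ≠ 0 := pow_ne_zero 2 hq0
  rw [tsum_eq_sum (s := range N) fun k hk => by
    rw [pairSum_eq_zero hp (by simpa using hk), zero_mul, zero_mul]]
  simp only [pairSum, sum_mul]
  rw [sum_comm, mul_sum, mul_sum, ← sum_add_distrib, ← sum_sub_distrib]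
  refine sum_congr rfl fun n hn => ?_
  have h := sum_shiftedPair_mul_weight hq0 hq n (mem_range.1 hn)
  simp only [mul_assoc] at h ⊢
  rw [← mul_sum, h, heckeTerm, heckeTerm, thetaSum_succ]
  ring

theorem norm_thetaSum_le {q : ℂ} (hq : ‖q‖ < 1) (n : ℕ) : ‖thetaSum q n‖ ≤ 2 * n + 1 := by
  refine (norm_sum_le_of_le _ (n := fun _ => 1) fun j _ => ?_).trans ?_
  · rw [norm_pow]
    exact pow_le_one₀ (norm_nonneg _) hq.le
  · rw [sum_const, Int.card_Icc, nsmul_one, show ((n : ℤ) + 1 - -n).toNat = 2 * n + 1 by omega]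
    push_cast
    rfl

theorem summable_heckeTerm {q : ℂ} (hq : ‖q‖ < 1) : Summable (heckeTerm q) := by
  have h1 := summable_pow_mul_geometric_of_norm_lt_one 1 (r := ‖q‖) (by simpa using hq)
  have h0 := summable_geometric_of_lt_one (norm_nonneg q) hq
  refine Summable.of_norm_bounded ((h1.mul_left 2).add h0) fun n => ?_
  rw [heckeTerm, norm_mul, norm_mul, norm_pow, norm_pow, norm_neg, norm_one, one_pow, one_mul]
  have h2 := norm_thetaSum_le hq n
  have h3 : ‖q‖ ^ (2 * n ^ 2) ≤ ‖q‖ ^ n :=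
    pow_le_pow_of_le_one (norm_nonneg q) hq.le (by nlinarith)
  calc _ ≤ ‖q‖ ^ n * (2 * n + 1) := by gcongr
    _ = _ := by ring

theorem summable_theta_term {q : ℂ} (hq : ‖q‖ < 1) :
    Summable fun n : ℕ => (-1) ^ n * q ^ (3 * n ^ 2) := by
  refine Summable.of_norm_bounded (summable_geometric_of_lt_one (norm_nonneg q) hq) fun n => ?_
  rw [norm_mul, norm_pow, norm_pow, norm_neg, norm_one, one_pow, one_mul]
  exact pow_le_pow_of_le_one (norm_nonneg q) hq.le (by nlinarith)

theorem tsum_eulerTerm {q : ℂ} (hq0 : q ≠ 0) (hq : ‖q‖ < 1) :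
    ∑' n, eulerTerm q n = 1 / 2 * ∑' n, heckeTerm q n + 1 / 2 * ∑' n, heckeTerm q (n + 1) -
      ∑' n : ℕ, (-1) ^ (n + 1) * q ^ (3 * (n + 1) ^ 2) := by
  have hE := tendsto_tsum_of_dominated_convergence (summable_dominatingTerm hq0 hq)
    (tendsto_pairSum_mul_weight hq0 hq)
    (Eventually.of_forall fun N k => norm_pairSum_mul_weight_le hq0 hq N k)
  simp only [tsum_pairSum_mul_weight hq0 hq] at hE
  have hH := summable_heckeTerm hq
  have hH' := (summable_nat_add_iff 1).2 hH
  have hT := (summable_nat_add_iff 1).2 (summable_theta_term hq)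
  exact tendsto_nhds_unique hE (((hH.hasSum.tendsto_sum_nat.const_mul _).add
    (hH'.hasSum.tendsto_sum_nat.const_mul _)).sub hT.hasSum.tendsto_sum_nat)

/-- The terms at `n = 0` of the two sides, both equal to `1 / 2`, drop out. The case `q = 0`, where
`q⁻¹` would be a junk value, is trivial. -/
theorem summable_and_tsum_eulerTerm_succ {q : ℂ} (hq : ‖q‖ < 1) :
    Summable (fun n => eulerTerm q (n + 1)) ∧
      ∑' n, eulerTerm q (n + 1) =
        ∑' n, heckeTerm q (n + 1) - ∑' n : ℕ, (-1) ^ (n + 1) * q ^ (3 * (n + 1) ^ 2) := by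
  by_cases hq0 : q = 0
  · simp [hq0, eulerTerm, heckeTerm, summable_zero]
  · have hs := summable_eulerTerm hq0 hq
    refine ⟨(summable_nat_add_iff 1).2 hs, ?_⟩
    have h := tsum_eulerTerm hq0 hq
    rw [hs.tsum_eq_zero_add, (summable_heckeTerm hq).tsum_eq_zero_add] at h
    have h1 : eulerTerm q 0 = 1 / 2 := by norm_num [eulerTerm, qShiftedFactorial_zero]
    have h2 : heckeTerm q 0 = 1 := by simp [heckeTerm, thetaSum]
    rw [h1, h2] at h
    linear_combination h

theorem sum_Icc_eq_heckeTerm (q : ℂ) (n : ℕ) :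
    ∑ j ∈ Icc (-(n : ℤ)) (n : ℤ), (-1 : ℂ) ^ n * q ^ (2 * n ^ 2 + j.natAbs ^ 2) =
      heckeTerm q n := by
  rw [heckeTerm, thetaSum, mul_sum]
  exact sum_congr rfl fun j _ => by ring

theorem sum_Icc_add_one_eq_heckeTerm_sub (q : ℂ) (n : ℕ) :
    ∑ j ∈ Icc (-(n : ℤ) + 1) (n : ℤ), (-1 : ℂ) ^ n * q ^ (2 * n ^ 2 + j.natAbs ^ 2) =
      heckeTerm q n - (-1) ^ n * q ^ (3 * n ^ 2) := by
  simp only [pow_add, ← mul_assoc]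
  rw [heckeTerm, thetaSum_eq_add, ← mul_sum]
  ring


theorem theorem3p5 (q : ℂ) (hq : ‖q‖ < 1) :
    -- all the series involved converge (absolutely)
    Summable (fun n : ℕ+ => (-1 : ℂ) ^ (n : ℕ) * q ^ ((n : ℕ) ^ 2 + (n : ℕ)) /
      ((1 + q ^ (2 * (n : ℕ))) * qShiftedFactorial q (q ^ 2) n)) ∧
    Summable (fun n : ℕ+ => ∑ j ∈ Finset.Icc (-(n : ℤ)) (n : ℤ),
      (-1 : ℂ) ^ (n : ℕ) * q ^ (2 * (n : ℕ) ^ 2 + j.natAbs ^ 2)) ∧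
    Summable (fun n : ℕ+ => (-1 : ℂ) ^ (n : ℕ) * q ^ (3 * (n : ℕ) ^ 2)) ∧
    Summable (fun n : ℕ+ => ∑ j ∈ Finset.Icc (-(n : ℤ) + 1) (n : ℤ),
      (-1 : ℂ) ^ (n : ℕ) * q ^ (2 * (n : ℕ) ^ 2 + j.natAbs ^ 2)) ∧
    -- the identity
    ∑' n : ℕ+, (-1 : ℂ) ^ (n : ℕ) * q ^ ((n : ℕ) ^ 2 + (n : ℕ)) /
        ((1 + q ^ (2 * (n : ℕ))) * qShiftedFactorial q (q ^ 2) n) =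
      (∑' n : ℕ+, ∑ j ∈ Finset.Icc (-(n : ℤ)) (n : ℤ),
        (-1 : ℂ) ^ (n : ℕ) * q ^ (2 * (n : ℕ) ^ 2 + j.natAbs ^ 2)) -
      ∑' n : ℕ+, (-1 : ℂ) ^ (n : ℕ) * q ^ (3 * (n : ℕ) ^ 2) ∧
    -- its second form
    ∑' n : ℕ+, (-1 : ℂ) ^ (n : ℕ) * q ^ ((n : ℕ) ^ 2 + (n : ℕ)) /
        ((1 + q ^ (2 * (n : ℕ))) * qShiftedFactorial q (q ^ 2) n) =
      ∑' n : ℕ+, ∑ j ∈ Finset.Icc (-(n : ℤ) + 1) (n : ℤ),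
        (-1 : ℂ) ^ (n : ℕ) * q ^ (2 * (n : ℕ) ^ 2 + j.natAbs ^ 2) := by

  have hH : Summable fun n : ℕ+ => heckeTerm q n := (summable_heckeTerm hq).comp_injective
    PNat.coe_injective
  have hT : Summable fun n : ℕ+ => (-1 : ℂ) ^ (n : ℕ) * q ^ (3 * (n : ℕ) ^ 2) :=
    (summable_theta_term hq).comp_injective PNat.coe_injective
  obtain ⟨hE, hsum⟩ := summable_and_tsum_eulerTerm_succ hq
  have hE' : Summable fun n : ℕ+ => eulerTerm q n :=
    (summable_pnat_iff_summable_succ (f := eulerTerm q)).2 hE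
  have hsum' : ∑' n : ℕ+, eulerTerm q n =
      ∑' n : ℕ+, heckeTerm q n - ∑' n : ℕ+, (-1 : ℂ) ^ (n : ℕ) * q ^ (3 * (n : ℕ) ^ 2) := by
    rw [tsum_pnat_eq_tsum_succ (f := eulerTerm q), tsum_pnat_eq_tsum_succ (f := heckeTerm q),
      tsum_pnat_eq_tsum_succ (f := fun n : ℕ => (-1 : ℂ) ^ n * q ^ (3 * n ^ 2)), hsum]
  simp only [sum_Icc_eq_heckeTerm, sum_Icc_add_one_eq_heckeTerm_sub]
  exact ⟨hE', hH, hT, hH.sub hT, hsum', hsum'.trans (hH.tsum_sub hT).symm⟩
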